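/- **Setting.** Let $1\le k\le\infty$, let $M$ and $N$ be (boundaryless, real) Banach manifolds, $M$ of class $C^{k+1}$ and $N$ of class $C^k$, modelled on Banach spaces. Let $(\alpha,\mathcal D,g)$ be a $C^k$ skew critical problem: $\alpha$ is a $C^k$ one-form on $M$, $\mathcal D$ is a $C^k$ distribution on $M$ (a $C^k$ subbundle of $TM$ with complemented fibres), and $g\colon M\to N$ is a $C^k$ submersion, i.e. every $T_mg$ is surjective with complemented kernel. A point $m\in M$ is a *skew critical point of $(\alpha,\mathcal D,g)$ at $n\in N$* if $\alpha(m)(v)=0$ for all $v\in\mathcal D_m$ and $g(m)=n$. At a skew critical point $m$ define, for $u\in\ker T_mg$ and $v\in\mathcal D_m$, $$d_{\mathcal D,g}\alpha(m)(u,v)=\bigl\langle d(i_V\alpha)(m),u\bigr\rangle ,$$ where $V$ is any local $C^k$ vector field with values in $\mathcal D$ and $V(m)=v$ (the value does not depend on $V$). The skew critical point $m$ is *nondegenerate* if $u\mapsto d_{\mathcal D,g}\alpha(m)(u,\cdot)$ is a linear isomorphism (of Banach spaces) $\ker T_mg\to\mathcal D_m^*$. **Theorem.** Suppose that $N$ is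 paracompact and Hausdorff, and that (a) $M_0$ is a closed $C^k$ submanifold of $M$, $N_0$ is a closed $C^k$ submanifold of $N$, and $\gamma_0\colon N_0\to M_0$ is a $C^k$ diffeomorphism; (b) for all $n\in N_0$, $\gamma_0(n)$ is a nondegenerate skew critical point of $(\alpha,\mathcal D,g)$ at $n$. Then there are open sets $U\subseteq M$ and $V\subseteq N$ with $U\supseteq M_0$ and $V\supseteq N_0$, and a $C^k$ map $\gamma\colon V\to U$ with $\gamma|_{N_0}=\gamma_0$, such that for every $n\in V$: 1. $\gamma(n)$ is a skew critical point of $(\alpha,\mathcal D,g)$ at $n$; and 2. $\gamma(n)$ is the unique skew critical point of $(\alpha,\mathcal D,g)$ at $n$ in $U$. -/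

import Mathlib

open Set Filter Topology Manifold Bundle

noncomputable section

namespace SkewCritical

/-- A subset `S` of a manifold `M` is an (embedded) `C^k` submanifold if around each of its points
there is a `C^k` chart of `M` in which `S` is a slice by a closed complemented linear subspace of
the model space. The subspace may depend on the point. -/
def IsSubmanifold {E : Type*} [NormedAddCommGroup E] [NormedSpace ℝ E] {H : Type*}
    [TopologicalSpace H] (I : ModelWithCorners ℝ E H) {M : Type*} [TopologicalSpace M]
    [ChartedSpace H M] (k : ℕ∞) (S : Set M) : Prop :=
  ∀ x ∈ S, ∃ φ ∈ IsManifold.maximalAtlas I (k : WithTop ℕ∞) M, x ∈ φ.source ∧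
    ∃ F : Submodule ℝ E, F.ClosedComplemented ∧
      ∀ y ∈ φ.source, (y ∈ S ↔ I (φ y) - I (φ x) ∈ F)

/-- `f` restricts to a `C^k` diffeomorphism from the submanifold `S` onto the submanifold `T`.
On a submanifold (a slice by a complemented subspace in suitable charts), `ContMDiffOn` says
exactly that the restriction is a `C^k` map on the submanifold. -/
structure IsDiffeoOn {E F : Type*} [NormedAddCommGroup E] [NormedSpace ℝ E]
    [NormedAddCommGroup F] [NormedSpace ℝ F] {H G : Type*} [TopologicalSpace H]
    [TopologicalSpace G] (J : ModelWithCorners ℝ F G) (I : ModelWithCorners ℝ E H)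
    {N M : Type*} [TopologicalSpace N] [ChartedSpace G N] [TopologicalSpace M] [ChartedSpace H M]
    (k : ℕ∞) (f : N → M) (S : Set N) (T : Set M) : Prop where
  bijOn : BijOn f S T
  contMDiffOn : ContMDiffOn J I (k : WithTop ℕ∞) f S
  exists_inverse : ∃ h : M → N, InvOn h f S T ∧ ContMDiffOn I J (k : WithTop ℕ∞) h T

/-- `D` is a `C^k` distribution, i.e. a `C^k` subbundle of the tangent bundle: near each point there
is a `C^k` vector bundle chart `Φ` of `TM`, over an open set `U`, which identifies `D` over `U`
with `U × A` for a fixed closed complemented subspace `A` of the model space. -/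
def IsDistribution {E : Type*} [NormedAddCommGroup E] [NormedSpace ℝ E] {H : Type*}
    [TopologicalSpace H] (I : ModelWithCorners ℝ E H) {M : Type*} [TopologicalSpace M]
    [ChartedSpace H M] [IsManifold I 1 M] (k : ℕ∞)
    (D : ∀ m : M, Submodule ℝ (TangentSpace I m)) : Prop :=
  ∀ m₀ : M, ∃ U : Set M, IsOpen U ∧ m₀ ∈ U ∧
    ∃ A : Submodule ℝ E, A.ClosedComplemented ∧
      ∃ Φ : ∀ m : M, E ≃L[ℝ] TangentSpace I m,
        ContMDiffOn I (I.prod 𝓘(ℝ, E →L[ℝ] E)) (k : WithTop ℕ∞)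
          (fun m => TotalSpace.mk' (E →L[ℝ] E)
            (E := fun m : M => Trivial M E m →L[ℝ] TangentSpace I m) m
            (Φ m : E →L[ℝ] TangentSpace I m)) U ∧
        ∀ m ∈ U, ∀ v : E, Φ m v ∈ D m ↔ v ∈ A

/-- A `C^k` skew critical problem `(α, D, g)`: a `C^k` one-form `α` and a `C^k` distribution `D`
on `M`, and a `C^k` submersion `g : M → N` (surjective tangent maps with split kernels). -/
structure SkewCriticalProblem {E F : Type*} [NormedAddCommGroup E] [NormedSpace ℝ E]
    [NormedAddCommGroup F] [NormedSpace ℝ F] {H G : Type*} [TopologicalSpace H]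
    [TopologicalSpace G] (I : ModelWithCorners ℝ E H) (J : ModelWithCorners ℝ F G)
    (M N : Type*) [TopologicalSpace M] [ChartedSpace H M] [IsManifold I 1 M]
    [TopologicalSpace N] [ChartedSpace G N] (k : ℕ∞) where
  /-- the one-form -/
  α : ∀ m : M, TangentSpace I m →L[ℝ] ℝ
  /-- the distribution -/
  D : ∀ m : M, Submodule ℝ (TangentSpace I m)
  /-- the constraint map -/
  g : M → N
  contMDiff_α : ContMDiff I (I.prod 𝓘(ℝ, E →L[ℝ] ℝ)) (k : WithTop ℕ∞)
    (fun m => TotalSpace.mk' (E →L[ℝ] ℝ)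
      (E := fun m : M => TangentSpace I m →L[ℝ] Trivial M ℝ m) m (α m))
  isDistribution_D : IsDistribution I k D
  contMDiff_g : ContMDiff I J (k : WithTop ℕ∞) g
  surjective_mfderiv_g : ∀ m : M, Function.Surjective (mfderiv I J g m)
  ker_mfderiv_g_complemented : ∀ m : M, (mfderiv I J g m).ker.ClosedComplemented

namespace SkewCriticalProblem

variable {E F : Type*} [NormedAddCommGroup E] [NormedSpace ℝ E]
  [NormedAddCommGroup F] [NormedSpace ℝ F] {H G : Type*} [TopologicalSpace H]
  [TopologicalSpace G] {I : ModelWithCorners ℝ E H} {J : ModelWithCorners ℝ F G}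
  {M N : Type*} [TopologicalSpace M] [ChartedSpace H M] [IsManifold I 1 M]
  [TopologicalSpace N] [ChartedSpace G N] {k : ℕ∞}

/-- `m` is a skew critical point of `(α, D, g)` at `n`. -/
def IsCriticalAt (P : SkewCriticalProblem I J M N k) (m : M) (n : N) : Prop :=
  (∀ v ∈ P.D m, P.α m v = 0) ∧ P.g m = n

/-- `V` is, near `m`, a `C^k` vector field with values in `D`, and `V m = v`. -/
def IsExtension (P : SkewCriticalProblem I J M N k) (m : M) (v : P.D m)
    (V : ∀ x : M, TangentSpace I x) : Prop :=
  (∃ U : Set M, IsOpen U ∧ m ∈ U ∧ (∀ x ∈ U, V x ∈ P.D x) ∧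
    ContMDiffOn I I.tangent (k : WithTop ℕ∞) (fun x => (⟨x, V x⟩ : TangentBundle I M)) U) ∧
  V m = v

theorem exists_isExtension (P : SkewCriticalProblem I J M N k) (m : M) (v : P.D m) :
    ∃ V : ∀ x : M, TangentSpace I x, P.IsExtension m v V := by
  obtain ⟨U, hU, hm, A, -, Φ, hΦ, hA⟩ := P.isDistribution_D m
  refine ⟨fun x => Φ x ((Φ m).symm v), ⟨U, hU, hm, fun x hx => ?_, ?_⟩, by simp⟩
  · rw [hA x hx, ← hA m hm]
    simp
  · exact hΦ.clm_bundle_apply (v := fun x => ((Φ m).symm v : Trivial M E x))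
      (fun x _ => by
        rw [contMDiffWithinAt_totalSpace]
        exact ⟨contMDiffWithinAt_id, contMDiffWithinAt_const⟩)

/-- The bilinear form `d_D α(m)(u, v) = ⟨d(i_V α)(m), u⟩`, where `V` is any local vector field with
values in `D` such that `V m = v`; `skewHessian_eq` shows that at a skew critical point it does not
depend on `V`. -/
def skewHessian (P : SkewCriticalProblem I J M N k) (m : M) (u : TangentSpace I m) (v : P.D m) :
    ℝ :=
  mfderiv I 𝓘(ℝ, ℝ) (fun x : M => P.α x ((P.exists_isExtension m v).choose x)) m u

/-- Near `m` the one-form and any local extension can be read in a vector bundle chart of `TM`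
adapted to `D`: `i_V α = a(x)(w(x))` with `a`, `w` of class `C^k` and `w` valued in the fixed
complemented subspace `A`. -/
theorem exists_local_form [CompleteSpace E] (P : SkewCriticalProblem I J M N k) (m : M) :
    ∃ A : Submodule ℝ E, A.ClosedComplemented ∧
      ∃ (Φ : ∀ x : M, E ≃L[ℝ] TangentSpace I x) (a : M → E →L[ℝ] ℝ),
        ContMDiffAt I 𝓘(ℝ, E →L[ℝ] ℝ) (k : WithTop ℕ∞) a m ∧
        (∀ x v, a x v = P.α x (Φ x v)) ∧ (∀ v, Φ m v ∈ P.D m ↔ v ∈ A) ∧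
        ∀ (v : P.D m) (V : ∀ x : M, TangentSpace I x), P.IsExtension m v V →
          ContMDiffAt I 𝓘(ℝ, E) (k : WithTop ℕ∞) (fun x => (Φ x).symm (V x)) m ∧
          (∀ᶠ x in 𝓝 m, (Φ x).symm (V x) ∈ A) := by
  obtain ⟨U, hU, hm, A, hAc, Φ, hΦ, hA⟩ := P.isDistribution_D m
  have hUm : U ∈ 𝓝 m := hU.mem_nhds hm
  have hΦm := hΦ.contMDiffAt hUm
  have hmb := FiberBundle.mem_baseSet_trivializationAt' (F := E) (E := (TangentSpace I : M → Type _)) m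
  have hb : ∀ᶠ x in 𝓝 m, x ∈ (trivializationAt E (TangentSpace I) m).baseSet :=
    (trivializationAt E (TangentSpace I) m).open_baseSet.mem_nhds hmb
  have hΦ' := ((contMDiffAt_hom_bundle _).1 hΦm).2
  have hT (x : M) : x ∈ (trivializationAt E (Trivial M E) m).baseSet := by simp
  refine ⟨A, hAc, Φ, fun x => (P.α x).comp (Φ x : E →L[ℝ] TangentSpace I x), ?_, fun _ _ => rfl,
    hA m hm, fun v V hV => ?_⟩
  · have hα' := ((contMDiffAt_hom_bundle _).1 (P.contMDiff_α m)).2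
    refine (hα'.clm_comp hΦ').congr_of_eventuallyEq ?_
    filter_upwards [hb] with x hx
    have hx0 : x ∈ (trivializationAt ℝ (Trivial M ℝ) m).baseSet := by simp
    rw [ContinuousLinearMap.inCoordinates_eq hx hx0, ContinuousLinearMap.inCoordinates_eq (hT x) hx]
    ext y
    have h := ((trivializationAt E (TangentSpace I) m).continuousLinearEquivAt ℝ x
      hx).symm_apply_apply (Φ x y)
    simp
    exact congrArg (P.α x) h.symm
  · obtain ⟨⟨W, hW, hmW, hVD, hVs⟩, -⟩ := hV
    have hVm := hVs.contMDiffAt (hW.mem_nhds hmW)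
    constructor
    · have hV' := (contMDiffAt_totalSpace.1 hVm).2
      set t := trivializationAt E (TangentSpace I) m with ht
      set Ψ : M → E →L[ℝ] E := fun x => ContinuousLinearMap.inCoordinates E (Trivial M E) E
        (TangentSpace I) m x m x (Φ x : E →L[ℝ] TangentSpace I x) with hΨ
      have hΨx (x : M) (hx : x ∈ t.baseSet) :
          Ψ x = ((Φ x).trans (t.continuousLinearEquivAt ℝ x hx) : E ≃L[ℝ] E) := by
        rw [hΨ]
        simp only
        rw [ContinuousLinearMap.inCoordinates_eq (hT x) hx]
        ext y
        simp
        rfl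
      have hinv := (contDiffAt_map_inverse (𝕜 := ℝ) (n := (k : WithTop ℕ∞))
        ((Φ m).trans (t.continuousLinearEquivAt ℝ m hmb) : E ≃L[ℝ] E)).contMDiffAt
      rw [← hΨx m hmb] at hinv
      have hinv' := hinv.comp m hΦ'
      refine (hinv'.clm_apply hV').congr_of_eventuallyEq ?_
      filter_upwards [hb] with x hx
      change _ = (ContinuousLinearMap.inverse (Ψ x)) _
      rw [hΨx x hx, ContinuousLinearMap.inverse_equiv]
      have : (t (⟨x, V x⟩ : TangentBundle I M)).2 = t.continuousLinearEquivAt ℝ x hx (V x) := rfl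
      change _ = ((Φ x).trans (t.continuousLinearEquivAt ℝ x hx)).symm
        (t (⟨x, V x⟩ : TangentBundle I M)).2
      rw [this]
      change _ = (Φ x).symm ((t.continuousLinearEquivAt ℝ x hx).symm
        (t.continuousLinearEquivAt ℝ x hx (V x)))
      rw [ContinuousLinearEquiv.symm_apply_apply]
    · filter_upwards [hUm, hW.mem_nhds hmW] with x hx hxW
      rw [← hA x hx]
      simpa using hVD x hxW

/-- At a skew critical point the skew Hessian does not depend on the local extension. -/
theorem skewHessian_eq [CompleteSpace E] (hk : 1 ≤ k) (P : SkewCriticalProblem I J M N k) {m : M}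
    {n : N} (hm : P.IsCriticalAt m n) (u : TangentSpace I m) (v : P.D m)
    (V : ∀ x : M, TangentSpace I x) (hV : P.IsExtension m v V) :
    P.skewHessian m u v = mfderiv I 𝓘(ℝ, ℝ) (fun x : M => P.α x (V x)) m u := by
  obtain ⟨A, ⟨Q, hQ⟩, Φ, a, ha, haα, hA, h⟩ := P.exists_local_form m
  have hk0 : (k : WithTop ℕ∞) ≠ 0 := by
    rintro h0
    have : k = 0 := by exact_mod_cast h0
    simp [this] at hk
  have key : ∀ V, P.IsExtension m v V → mfderiv I 𝓘(ℝ, ℝ) (fun x : M => P.α x (V x)) m u =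
      (fderivWithin ℝ (a ∘ (extChartAt I m).symm) (range I) (extChartAt I m m) u : E →L[ℝ] ℝ)
        ((Φ m).symm v) := by
    intro V hV
    obtain ⟨hw, hwA⟩ := h v V hV
    have e1 : (fun x : M => P.α x (V x)) = fun x => a x ((Φ x).symm (V x)) := by
      funext x; simp [haα]
    set w : M → E := fun x => (Φ x).symm (V x) with hwdef
    have mda := ha.mdifferentiableAt hk0
    have mdw := hw.mdifferentiableAt hk0
    have da := mda.differentiableWithinAt_writtenInExtChartAt.hasFDerivWithinAt
    have dw := mdw.differentiableWithinAt_writtenInExtChartAt.hasFDerivWithinAt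
    simp only [writtenInExtChartAt, extChartAt_model_space_eq_id, PartialEquiv.refl_coe,
      Function.id_comp] at da dw
    have hu : UniqueDiffWithinAt ℝ (range I) (extChartAt I m m) :=
      I.uniqueDiffOn _ (mem_range_self _)
    have hs : Tendsto (extChartAt I m).symm (𝓝[range I] (extChartAt I m m)) (𝓝 m) := by
      have := (continuousAt_extChartAt_symm (I := I) m).tendsto
      rw [extChartAt_to_inv] at this
      exact this.mono_left nhdsWithin_le_nhds
    have hsymm : (extChartAt I m).symm (extChartAt I m m) = m := extChartAt_to_inv m
    have hRA : ∀ z ∈ A, (A.subtypeL.comp Q - ContinuousLinearMap.id ℝ E) z = 0 := by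
      intro z hz
      change (Q z : E) - z = 0
      rw [hQ ⟨z, hz⟩, sub_self]
    -- the derivative of `w` takes values in `A`
    have hdA : ∀ u : E, fderivWithin ℝ (w ∘ (extChartAt I m).symm) (range I)
        (extChartAt I m m) u ∈ A := by
      intro u
      set R : E →L[ℝ] E := A.subtypeL.comp Q - ContinuousLinearMap.id ℝ E with hR
      have h1 := R.hasFDerivAt.comp_hasFDerivWithinAt (extChartAt I m m) dw
      have h2 : HasFDerivWithinAt (R ∘ (w ∘ (extChartAt I m).symm)) (0 : E →L[ℝ] E) (range I)
          (extChartAt I m m) := by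
        refine (hasFDerivWithinAt_const (0 : E) _ _).congr_of_eventuallyEq ?_ ?_
        · filter_upwards [hs.eventually hwA] with y hy
          exact hRA _ hy
        · refine hRA _ ?_
          simp only [Function.comp, hsymm]
          exact hwA.self_of_nhds
      have h3 := hu.eq h1 h2
      have h4 := congrArg (fun L : E →L[ℝ] E => L u) h3
      have h5 := sub_eq_zero.1 (show (Q (fderivWithin ℝ (w ∘ (extChartAt I m).symm) (range I)
        (extChartAt I m m) u) : E) - fderivWithin ℝ (w ∘ (extChartAt I m).symm) (range I)
        (extChartAt I m m) u = 0 from h4)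
      rw [← h5]
      exact SetLike.coe_mem _
    have hprod := da.clm_apply dw
    have hmd : MDifferentiableAt I 𝓘(ℝ, ℝ) (fun x => a x (w x)) m := mda.clm_apply mdw
    rw [e1, hmd.mfderiv]
    simp only [writtenInExtChartAt, extChartAt_model_space_eq_id, PartialEquiv.refl_coe,
      Function.id_comp]
    rw [show ((fun x => a x (w x)) ∘ (extChartAt I m).symm) = fun y =>
      (a ∘ (extChartAt I m).symm) y ((w ∘ (extChartAt I m).symm) y) from rfl, hprod.fderivWithin hu]
    have h5 := hm.1 _ ((hA _).2 (hdA u))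
    rw [← haα] at h5
    have hwm : w m = (Φ m).symm v := by rw [hwdef]; simp [hV.2]
    have e2 : (w ∘ (extChartAt I m).symm) (extChartAt I m m) = (Φ m).symm v := by
      simp only [Function.comp, hsymm, hwm]
    have e3 : (a ∘ (extChartAt I m).symm) (extChartAt I m m) = a m := by
      simp only [Function.comp, hsymm]
    rw [e2, e3]
    exact (congrArg (· + _) h5).trans (zero_add _)
  rw [key V hV]
  exact key _ (P.exists_isExtension m v).choose_spec

/-- A skew critical point `m` at `n` is nondegenerate if the restriction of the skew Hessian to
`ker T_m g × D_m` induces a linear isomorphism (of Banach spaces) `ker T_m g ≃ (D_m)^*`. -/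
def IsNondegenerateAt (P : SkewCriticalProblem I J M N k) (m : M) (n : N) : Prop :=
  P.IsCriticalAt m n ∧
    ∃ B : (mfderiv I J P.g m).ker ≃L[ℝ] (P.D m →L[ℝ] ℝ),
      ∀ (u : (mfderiv I J P.g m).ker) (v : P.D m), B u v = P.skewHessian m u v

end SkewCriticalProblem

end SkewCritical

end

/-!
Near a nondegenerate skew critical point `m`, a vector bundle chart of the tangent bundle adapted
to `D` identifies `D` with a fixed closed subspace `A` of the model space. Reading `α` in this chart
and restricting it to `A` gives a `C^k` map `f` into the dual of `A` whose zeros are the points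
where `α` annihilates `D` (`exists_local_equations`). The skew critical points at `n` near `m` are
thus the solutions of `f x = 0`, `g x = n`. On `ker T_m g` the derivative of `f` is the skew
Hessian, so nondegeneracy and surjectivity of `T_m g` say that the derivative of `(f, g)` is
bijective (`bijective_of_isNondegenerateAt`). By the inverse function theorem `(f, g)` is a local
`C^k` diffeomorphism, and `n ↦ (f, g)⁻¹ (0, n)` is a local section of `g` through `m` whose
values are exactly the skew critical points close to `m` (`exists_local_section`).

The local sections are then glued over a neighbourhood of the closed set `N₀`
(`exists_open_glued_section`). By uniqueness and continuity, two of them agree near each point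
of `N₀` at which both are defined. Paracompactness provides a locally finite family of domains,
so near a point of `N₀` only finitely many such agreements are needed, and all the sections agree
on an open set containing `N₀`. The argument takes place over `N`; `M` need not be Hausdorff.
-/

namespace SkewCritical

/-! ### The inverse function theorem on an open set -/

/-- A form of the inverse function theorem that gives `C^k` regularity of the inverse on its whole
domain. For `k = ∞` this does not follow from `C^k` regularity of the inverse at the single point
`f x`: it uses that the derivative of `f` is invertible at all points near `x`. -/
theorem exists_openPartialHomeomorph_contDiffOn_symm {E F : Type*}
    [NormedAddCommGroup E] [NormedSpace ℝ E] [CompleteSpace E]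
    [NormedAddCommGroup F] [NormedSpace ℝ F] [CompleteSpace F]
    {k : WithTop ℕ∞} (hk : k ≠ 0) {f : E → F}
    {Ω : Set E} (hΩ : IsOpen Ω) (hf : ContDiffOn ℝ k f Ω) {x : E} (hx : x ∈ Ω) {f' : E →L[ℝ] F}
    (hf' : HasFDerivAt f f' x) (hbij : Function.Bijective f') :
    ∃ e : OpenPartialHomeomorph E F, x ∈ e.source ∧ e.source ⊆ Ω ∧ (∀ y, e y = f y) ∧
      ContDiffOn ℝ k e.symm e.target := by
  obtain ⟨L₀, rfl⟩ : ∃ L₀ : E ≃L[ℝ] F, (L₀ : E →L[ℝ] F) = f' :=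
    ⟨_, ContinuousLinearEquiv.coe_ofBijective f' (LinearMap.ker_eq_bot.2 hbij.1)
      (LinearMap.range_eq_top.2 hbij.2)⟩
  have hfx : ContDiffAt ℝ k f x := hf.contDiffAt (hΩ.mem_nhds hx)
  set e₀ := hfx.toOpenPartialHomeomorph f hf' hk
  have hcont : ContinuousAt (fderiv ℝ f) x := hfx.continuousAt_fderiv hk
  -- invertibility of the derivative persists near `x`
  have hinv : ∀ᶠ y in 𝓝 x, fderiv ℝ f y ∈ range ((↑) : (E ≃L[ℝ] F) → E →L[ℝ] F) := by
    refine hcont ?_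
    rw [hf'.fderiv]
    exact ContinuousLinearEquiv.nhds L₀
  obtain ⟨W, hW, hWo, hxW⟩ := eventually_nhds_iff.1 hinv
  refine ⟨e₀.restrOpen (Ω ∩ W) (hΩ.inter hWo), ?_, ?_, fun _ => rfl, ?_⟩
  · exact ⟨hfx.mem_toOpenPartialHomeomorph_source hf' hk, hx, hxW⟩
  · exact fun y hy => hy.2.1
  · intro z hz
    set e := e₀.restrOpen (Ω ∩ W) (hΩ.inter hWo)
    have hy : e.symm z ∈ Ω ∩ W := (e.map_target hz).2
    obtain ⟨L, hL⟩ := hW _ hy.2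
    have hfy : ContDiffAt ℝ k f (e.symm z) := hf.contDiffAt (hΩ.mem_nhds hy.1)
    have hd := (hfy.differentiableAt hk).hasFDerivAt
    rw [← hL] at hd
    exact (e.contDiffAt_symm hz hd hfy).contDiffWithinAt

/-! ### Gluing local sections along a closed set -/

/-- Let `s₀` be a continuous section of `g` over a closed set `N₀`, with values in `C`. If it extends
locally to `C^k` sections with values in `C`, locally unique as such, then it extends to a `C^k`
section over a neighbourhood of `N₀` with the same uniqueness. -/
theorem exists_open_glued_section {E F : Type*} [NormedAddCommGroup E] [NormedSpace ℝ E]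
    [NormedAddCommGroup F] [NormedSpace ℝ F] {H G : Type*} [TopologicalSpace H]
    [TopologicalSpace G] {I : ModelWithCorners ℝ E H} {J : ModelWithCorners ℝ F G}
    {M N : Type*} [TopologicalSpace M] [ChartedSpace H M] [TopologicalSpace N] [ChartedSpace G N]
    [T2Space N] [ParacompactSpace N] {k : WithTop ℕ∞} {C : Set M} {g : M → N} (hg : Continuous g)
    {N₀ : Set N} (hN₀ : IsClosed N₀) {s₀ : N → M} (hs₀ : ContinuousOn s₀ N₀)
    (hs₀C : ∀ n ∈ N₀, s₀ n ∈ C ∧ g (s₀ n) = n)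
    (hloc : ∀ n ∈ N₀, ∃ (U : Set M) (V : Set N) (s : N → M), IsOpen U ∧ s₀ n ∈ U ∧ IsOpen V ∧
      n ∈ V ∧ MapsTo s V U ∧ ContMDiffOn J I k s V ∧ (∀ y ∈ V, s y ∈ C ∧ g (s y) = y) ∧
      ∀ y ∈ V, ∀ m ∈ U, m ∈ C → g m = y → m = s y) :
    ∃ (U : Set M) (V : Set N) (s : N → M), IsOpen U ∧ s₀ '' N₀ ⊆ U ∧ IsOpen V ∧ N₀ ⊆ V ∧
      MapsTo s V U ∧ ContMDiffOn J I k s V ∧ EqOn s s₀ N₀ ∧ (∀ y ∈ V, s y ∈ C ∧ g (s y) = y) ∧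
      ∀ y ∈ V, ∀ m ∈ U, m ∈ C → g m = y → m = s y := by
  have : Nonempty (N → M) := ⟨s₀⟩
  choose! U V s hUo hmU hVo hnV hsVU hsk hsC huniq using hloc
  -- shrink the domains so that `s n` agrees with `s₀` on the part of `N₀` in its domain
  have hshrink : ∀ n ∈ N₀, ∃ V' : Set N, IsOpen V' ∧ n ∈ V' ∧ V' ⊆ V n ∧
      ∀ y ∈ V' ∩ N₀, s₀ y ∈ U n := by
    intro n hn
    obtain ⟨u, hu, hu'⟩ := continuousOn_iff'.1 hs₀ (U n) (hUo n hn)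
    have hmem : ∀ y ∈ N₀, s₀ y ∈ U n ↔ y ∈ u := fun y hy => by
      simpa [hy] using Set.ext_iff.1 hu' y
    exact ⟨V n ∩ u, (hVo n hn).inter hu, ⟨hnV n hn, (hmem n hn).1 (hmU n hn)⟩,
      inter_subset_left, fun y hy => (hmem y hy.2).2 hy.1.2⟩
  choose! V' hV'o hnV' hV'V hV'U using hshrink
  have hs_eq : ∀ n ∈ N₀, ∀ y ∈ V' n ∩ N₀, s n y = s₀ y := fun n hn y hy =>
    (huniq n hn y (hV'V n hn hy.1) _ (hV'U n hn y hy) (hs₀C y hy.2).1 (hs₀C y hy.2).2).symm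
  obtain ⟨W, hWo, hN₀W, hWfin, hWV⟩ := precise_refinement_set hN₀ (fun n : N₀ => V' n)
    (fun n => hV'o n n.2) (fun n hn => mem_iUnion.2 ⟨⟨n, hn⟩, hnV' n hn⟩)
  obtain ⟨X, hN₀X, hXo, hXW⟩ := exists_subset_iUnion_closure_subset hN₀ hWo
    (fun n _ => hWfin.point_finite n) hN₀W
  have hXV : ∀ i, closure (X i) ⊆ V' i := fun i => (hXW i).trans (hWV i)
  have hXfin : LocallyFinite fun i => closure (X i) := hWfin.subset hXW
  -- two local sections agree near every point of `N₀` in both domains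
  have hagree : ∀ i j : N₀, ∀ n ∈ N₀, n ∈ V' i → n ∈ V' j → ∀ᶠ y in 𝓝 n, s i y = s j y := by
    intro i j n hn hi hj
    have hc : ContinuousAt (s i) n :=
      ((hsk i i.2).contMDiffAt ((hVo i i.2).mem_nhds (hV'V i i.2 hi))).continuousAt
    have hU : U j ∈ 𝓝 (s i n) := by
      rw [hs_eq i i.2 n ⟨hi, hn⟩]
      exact (hUo j j.2).mem_nhds (hV'U j j.2 n ⟨hj, hn⟩)
    filter_upwards [hc hU, (hV'o i i.2).mem_nhds hi, (hV'o j j.2).mem_nhds hj] with y hy hyi hyj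
    obtain ⟨h1, h2⟩ := hsC i i.2 y (hV'V i i.2 hyi)
    exact huniq j j.2 y (hV'V j j.2 hyj) _ hy h1 h2
  -- over `O` all sections whose closed domain contains the point agree; the domains are closed
  -- so that, near a point of `N₀`, only the domains containing this point matter
  set O : Set N := {y | (∃ i, y ∈ X i) ∧
    ∀ i j, y ∈ closure (X i) → y ∈ closure (X j) → s i y = s j y} with hO
  have hN₀O : N₀ ⊆ interior O := by
    intro n hn
    rw [mem_interior_iff_mem_nhds]
    obtain ⟨i₀, hi₀⟩ := mem_iUnion.1 (hN₀X hn)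
    have hfin := hXfin.point_finite n
    have hall : ∀ᶠ y in 𝓝 n, ∀ i ∈ {i | n ∈ closure (X i)}, ∀ j ∈ {i | n ∈ closure (X i)},
        s i y = s j y :=
      (eventually_all_finite hfin).2 fun i hi => (eventually_all_finite hfin).2 fun j hj =>
        hagree i j n hn (hXV i hi) (hXV j hj)
    filter_upwards [(hXo i₀).mem_nhds hi₀, hall,
      hXfin.eventually_subset (fun i => isClosed_closure) n] with y hy0 hy hsub
    exact ⟨⟨i₀, hy0⟩, fun i j hi hj => hy i (hsub hi) j (hsub hj)⟩
  classical
  set γ : N → M := fun y => if h : ∃ i, y ∈ X i then s h.choose y else s₀ y with hγdef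
  have hγ : ∀ y ∈ interior O, ∀ i, y ∈ X i → γ y = s i y := by
    intro y hy i hi
    have h : ∃ i, y ∈ X i := ⟨i, hi⟩
    simp only [hγdef, dif_pos h]
    exact (interior_subset hy).2 _ _ (subset_closure h.choose_spec) (subset_closure hi)
  have hXV₀ : ∀ i, X i ⊆ V i := fun i => (subset_closure.trans (hXV i)).trans (hV'V i i.2)
  refine ⟨⋃ i : N₀, U i ∩ g ⁻¹' (X i ∩ interior O), interior O, γ, ?_, ?_, isOpen_interior, hN₀O,
    ?_, ?_, ?_, ?_, ?_⟩
  · exact isOpen_iUnion fun i =>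
      (hUo i i.2).inter (((hXo i).inter isOpen_interior).preimage hg)
  · rintro _ ⟨n, hn, rfl⟩
    obtain ⟨i, hi⟩ := mem_iUnion.1 (hN₀X hn)
    refine mem_iUnion.2 ⟨i, hV'U i i.2 n ⟨hXV i (subset_closure hi), hn⟩, ?_⟩
    rw [mem_preimage, (hs₀C n hn).2]
    exact ⟨hi, hN₀O hn⟩
  · intro y hy
    obtain ⟨i, hi⟩ := (interior_subset hy).1
    rw [hγ y hy i hi]
    refine mem_iUnion.2 ⟨i, hsVU i i.2 (hXV₀ i hi), ?_⟩
    rw [mem_preimage, (hsC i i.2 y (hXV₀ i hi)).2]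
    exact ⟨hi, hy⟩
  · intro y hy
    obtain ⟨i, hi⟩ := (interior_subset hy).1
    refine (((hsk i i.2).contMDiffAt ((hVo i i.2).mem_nhds (hXV₀ i hi))).congr_of_eventuallyEq
      ?_).contMDiffWithinAt
    filter_upwards [(hXo i).mem_nhds hi, isOpen_interior.mem_nhds hy] with z hzi hz
    exact hγ z hz i hzi
  · intro n hn
    obtain ⟨i, hi⟩ := mem_iUnion.1 (hN₀X hn)
    rw [hγ n (hN₀O hn) i hi]
    exact hs_eq i i.2 n ⟨hXV i (subset_closure hi), hn⟩
  · intro y hy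
    obtain ⟨i, hi⟩ := (interior_subset hy).1
    rw [hγ y hy i hi]
    exact hsC i i.2 y (hXV₀ i hi)
  · rintro y hy m hm hmC rfl
    obtain ⟨i, hmi, hi, -⟩ := mem_iUnion.1 hm
    rw [hγ _ hy i hi]
    exact huniq i i.2 _ (hXV₀ i hi) m hmi hmC rfl

/-! ### Local structure of the set of skew critical points -/

namespace SkewCriticalProblem

variable {E F : Type*} [NormedAddCommGroup E] [NormedSpace ℝ E]
  [NormedAddCommGroup F] [NormedSpace ℝ F] {H G : Type*} [TopologicalSpace H]
  [TopologicalSpace G] {I : ModelWithCorners ℝ E H} {J : ModelWithCorners ℝ F G}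
  {M N : Type*} [TopologicalSpace M] [ChartedSpace H M] [IsManifold I 1 M]
  [TopologicalSpace N] [ChartedSpace G N] {k : ℕ∞}

/-- In a vector bundle chart `Φ` of `TM` in which `D` becomes a constant subspace `A`, the restriction
of `α` to `D` becomes a `C^k` map `f` into the dual of `A`, and the vectors of `D m` extend to the
local vector fields which are constant in this chart. -/
theorem exists_local_equations (P : SkewCriticalProblem I J M N k) (m : M) :
    ∃ (U : Set M) (A : Submodule ℝ E) (Φ : ∀ x : M, E ≃L[ℝ] TangentSpace I x)
      (f : M → A →L[ℝ] ℝ), IsOpen U ∧ m ∈ U ∧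
      (∀ x ∈ U, ∀ v : E, Φ x v ∈ P.D x ↔ v ∈ A) ∧ (∀ x v, f x v = P.α x (Φ x v)) ∧
      ContMDiffOn I 𝓘(ℝ, A →L[ℝ] ℝ) (k : WithTop ℕ∞) f U ∧
      ∀ v : P.D m, P.IsExtension m v fun x => Φ x ((Φ m).symm v) := by
  obtain ⟨U, hU, hm, A, -, Φ, hΦ, hA⟩ := P.isDistribution_D m
  refine ⟨U, A, Φ, fun x => ((P.α x).comp (Φ x : E →L[ℝ] TangentSpace I x)).comp A.subtypeL,
    hU, hm, hA, fun _ _ => rfl, ?_, fun v => ⟨⟨U, hU, hm, fun x hx => ?_, ?_⟩, by simp⟩⟩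
  · suffices h : ContMDiffOn I 𝓘(ℝ, E →L[ℝ] ℝ) (k : WithTop ℕ∞)
        (fun x => ((P.α x).comp (Φ x : E →L[ℝ] TangentSpace I x) : E →L[ℝ] ℝ)) U from
      h.clm_comp contMDiffOn_const
    intro y hy
    refine ContMDiffAt.contMDiffWithinAt ?_
    -- `f` is the composition of the coordinate expressions of `α` and `Φ` in a chart of `TM` at `y`
    have hΦ' := ((contMDiffAt_hom_bundle _).1 (hΦ.contMDiffAt (hU.mem_nhds hy))).2
    have hα' := ((contMDiffAt_hom_bundle _).1 (P.contMDiff_α y)).2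
    have hb : ∀ᶠ x in 𝓝 y, x ∈ (trivializationAt E (TangentSpace I) y).baseSet :=
      (trivializationAt E (TangentSpace I) y).open_baseSet.mem_nhds
        (FiberBundle.mem_baseSet_trivializationAt' y)
    refine (hα'.clm_comp hΦ').congr_of_eventuallyEq ?_
    filter_upwards [hb] with x hx
    have hx0 : x ∈ (trivializationAt ℝ (Trivial M ℝ) y).baseSet := by simp
    have hxE : x ∈ (trivializationAt E (Trivial M E) y).baseSet := by simp
    rw [ContinuousLinearMap.inCoordinates_eq hx hx0, ContinuousLinearMap.inCoordinates_eq hxE hx]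
    ext z
    have h := ((trivializationAt E (TangentSpace I) y).continuousLinearEquivAt ℝ x
      hx).symm_apply_apply (Φ x z)
    simp
    exact congrArg (P.α x) h.symm
  · rw [hA x hx, ← hA m hm]
    simp
  · exact hΦ.clm_bundle_apply (v := fun x => ((Φ m).symm v : Trivial M E x))
      (fun x _ => by
        rw [contMDiffWithinAt_totalSpace]
        exact ⟨contMDiffWithinAt_id, contMDiffWithinAt_const⟩)

/-- At a nondegenerate skew critical point the equations `f x = 0`, `g x = n` have an invertible
linearization: on `ker T_m g` the derivative of `f` is the skew Hessian, an isomorphism onto the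
dual of `D m ≃ A`, and `T_m g` is surjective. -/
theorem bijective_of_isNondegenerateAt [CompleteSpace E] (hk : 1 ≤ k)
    (P : SkewCriticalProblem I J M N k) {m : M} {n : N} (h : P.IsNondegenerateAt m n)
    {A : Submodule ℝ E} {Φ : ∀ x : M, E ≃L[ℝ] TangentSpace I x} {f : M → A →L[ℝ] ℝ}
    (hA : ∀ v : E, Φ m v ∈ P.D m ↔ v ∈ A) (hfα : ∀ x v, f x v = P.α x (Φ x v))
    {f' : E →L[ℝ] (A →L[ℝ] ℝ)} (hf : HasMFDerivAt I 𝓘(ℝ, A →L[ℝ] ℝ) f m f')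
    (hext : ∀ v : P.D m, P.IsExtension m v fun x => Φ x ((Φ m).symm v)) :
    Function.Bijective (f'.prod (mfderiv I J P.g m : E →L[ℝ] F)) := by
  obtain ⟨hcrit, B, hB⟩ := h
  have hmem : ∀ v : P.D m, (Φ m).symm v ∈ A := fun v => by
    rw [← hA]; simp
  have hBf : ∀ (u : (mfderiv I J P.g m).ker) (v : P.D m),
      B u v = f' (u : TangentSpace I m) ⟨(Φ m).symm v, hmem v⟩ := by
    intro u v
    set w : A := ⟨(Φ m).symm v, hmem v⟩
    -- contracting `α` with the extension of `v` constant in the chart `Φ` gives `x ↦ f x w`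
    rw [hB, P.skewHessian_eq hk hcrit _ _ _ (hext v)]
    have e : (fun x => P.α x (Φ x ((Φ m).symm v))) =
        (ContinuousLinearMap.apply ℝ ℝ w : (A →L[ℝ] ℝ) →L[ℝ] ℝ) ∘ f := by
      funext x
      exact (hfα x w).symm
    have hc := (ContinuousLinearMap.hasMFDerivAt
      (ContinuousLinearMap.apply ℝ ℝ w : (A →L[ℝ] ℝ) →L[ℝ] ℝ) (x := f m)).comp m hf
    rw [e, hc.mfderiv]
    rfl
  constructor
  · refine (injective_iff_map_eq_zero
      (f'.prod (mfderiv I J P.g m : E →L[ℝ] F))).2 fun u hu => ?_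
    have hu1 : f' u = 0 := congrArg Prod.fst hu
    have hu2 : mfderiv I J P.g m u = 0 := congrArg Prod.snd hu
    have : B ⟨u, hu2⟩ = 0 := by
      ext v
      rw [hBf, hu1]
      rfl
    exact congrArg Subtype.val ((map_eq_zero_iff B B.injective).1 this)
  · rintro ⟨l, w⟩
    obtain ⟨u₁, hu₁⟩ : ∃ u₁ : E, (mfderiv I J P.g m : E →L[ℝ] F) u₁ = w :=
      P.surjective_mfderiv_g m w
    -- correct `u₁` by an element of the kernel of `T_m g`, using surjectivity of the skew Hessian
    set l' : A →L[ℝ] ℝ := l - f' u₁ with hl'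
    set b : P.D m →L[ℝ] ℝ := l'.comp ((((Φ m).symm : TangentSpace I m →L[ℝ] E).comp
      (P.D m).subtypeL).codRestrict A hmem)
    obtain ⟨u, hu⟩ := B.surjective b
    set u' : E := (u : TangentSpace I m)
    have hul : f' u' = l' := by
      ext v
      have hv : Φ m v ∈ P.D m := (hA v).2 v.2
      have h1 := hBf u ⟨Φ m v, hv⟩
      have h3 : (⟨(Φ m).symm (Φ m v), hmem ⟨Φ m v, hv⟩⟩ : A) = v :=
        Subtype.ext ((Φ m).symm_apply_apply v)
      have h2 : B u ⟨Φ m v, hv⟩ = l' ⟨(Φ m).symm (Φ m v), hmem ⟨Φ m v, hv⟩⟩ := by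
        rw [hu]; rfl
      rw [h2] at h1
      simp only [h3] at h1
      exact h1.symm
    have hug : (mfderiv I J P.g m : E →L[ℝ] F) u' = 0 := u.2
    refine ⟨u' + u₁, Prod.ext ?_ ?_⟩
    · refine (f'.map_add _ _).trans ?_
      rw [hul, hl']
      exact sub_add_cancel _ _
    · refine ((mfderiv I J P.g m : E →L[ℝ] F).map_add _ _).trans ?_
      rw [hug, hu₁, zero_add]

/-- Near a nondegenerate skew critical point, the skew critical points form the image of a `C^k`
local section of `g`. -/
theorem exists_local_section [CompleteSpace E] [CompleteSpace F] [I.Boundaryless]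
    [J.Boundaryless] [IsManifold I (k : WithTop ℕ∞) M] [IsManifold J (k : WithTop ℕ∞) N]
    (hk : 1 ≤ k) (P : SkewCriticalProblem I J M N k) {m : M} {n : N}
    (h : P.IsNondegenerateAt m n) :
    ∃ (U : Set M) (V : Set N) (s : N → M), IsOpen U ∧ m ∈ U ∧ IsOpen V ∧ n ∈ V ∧ MapsTo s V U ∧
      ContMDiffOn J I (k : WithTop ℕ∞) s V ∧ (∀ y ∈ V, P.IsCriticalAt (s y) y) ∧
      ∀ y ∈ V, ∀ x ∈ U, P.IsCriticalAt x y → x = s y := by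
  have hk0 : (k : WithTop ℕ∞) ≠ 0 := by
    rintro h0
    have : k = 0 := by exact_mod_cast h0
    simp [this] at hk
  obtain ⟨U₀, A, Φ, f, hU₀, hmU₀, hA, hfα, hf, hext⟩ := P.exists_local_equations m
  have hcrit_iff : ∀ x ∈ U₀, (∀ v ∈ P.D x, P.α x v = 0) ↔ f x = 0 := by
    intro x hx
    constructor
    · intro hv
      ext v
      exact (hfα x v).trans (hv _ ((hA x hx v).2 v.2))
    · intro hfx v hv
      have hv' : (Φ x).symm v ∈ A := by rw [← hA x hx]; simpa using hv
      have := hfα x ⟨(Φ x).symm v, hv'⟩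
      rw [hfx] at this
      simpa using this.symm
  obtain rfl : P.g m = n := h.1.2
  obtain ⟨f', hfm⟩ : ∃ f' : E →L[ℝ] (A →L[ℝ] ℝ), HasMFDerivAt I 𝓘(ℝ, A →L[ℝ] ℝ) f m f' :=
    ⟨_, ((hf.contMDiffAt (hU₀.mem_nhds hmU₀)).mdifferentiableAt hk0).hasMFDerivAt⟩
  have hgm : MDifferentiableAt I J P.g m := (P.contMDiff_g m).mdifferentiableAt hk0
  obtain ⟨g', hg'⟩ : ∃ g' : E →L[ℝ] F, mfderiv I J P.g m = g' := ⟨_, rfl⟩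
  have hg'm : HasMFDerivAt I J P.g m g' := hg' ▸ hgm.hasMFDerivAt
  have hbij : Function.Bijective (f'.prod g') :=
    hg' ▸ P.bijective_of_isNondegenerateAt hk h (hA m hmU₀) hfα hfm hext
  set φ := extChartAt I m with hφ
  set ψ := extChartAt J (P.g m) with hψ
  -- `Γ` is `(f, g)` in charts, on the part `Ω` of the chart domain where it is defined and `C^k`
  set Ω : Set E := φ.target ∩ φ.symm ⁻¹' (U₀ ∩ P.g ⁻¹' ψ.source) with hΩdef
  have hgc : Continuous P.g := P.contMDiff_g.continuous
  have hψo : IsOpen ψ.source := isOpen_extChartAt_source _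
  have hΩ : IsOpen Ω := (continuousOn_extChartAt_symm m).isOpen_inter_preimage
    (isOpen_extChartAt_target m) (hU₀.inter (hψo.preimage hgc))
  have hmΩ : φ m ∈ Ω := by
    refine ⟨mem_extChartAt_target m, ?_⟩
    rw [mem_preimage, hφ, extChartAt_to_inv]
    exact ⟨hmU₀, mem_extChartAt_source _⟩
  set Γ : E → (A →L[ℝ] ℝ) × F := fun y => (f (φ.symm y), ψ (P.g (φ.symm y))) with hΓ
  have hφs : ContMDiffOn 𝓘(ℝ, E) I (k : WithTop ℕ∞) φ.symm Ω :=
    (contMDiffOn_extChartAt_symm m).mono inter_subset_left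
  have hΓk : ContDiffOn ℝ (k : WithTop ℕ∞) Γ Ω := by
    refine ContDiffOn.prodMk ?_ ?_
    · exact contMDiffOn_iff_contDiffOn.1 (hf.comp hφs fun y hy => hy.2.1)
    · refine contMDiffOn_iff_contDiffOn.1 (ContMDiffOn.comp (t := ψ.source) ?_
        (P.contMDiff_g.comp_contMDiffOn hφs) fun y hy => hy.2.2)
      rw [hψ, extChartAt_source]
      exact contMDiffOn_extChartAt
  have hΓ' : HasFDerivAt Γ (f'.prod g') (φ m) := by
    have h1 : HasFDerivWithinAt (fun y => f (φ.symm y)) f' (range I) (φ m) := hfm.2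
    have h2 : HasFDerivWithinAt (fun y => ψ (P.g (φ.symm y))) g' (range I) (φ m) := hg'm.2
    rw [I.range_eq_univ, hasFDerivWithinAt_univ] at h1 h2
    exact HasFDerivAt.prodMk (f₁ := fun y => f (φ.symm y)) (f₁' := f')
      (f₂ := fun y => ψ (P.g (φ.symm y))) (f₂' := g') h1 h2
  obtain ⟨e, hme, heΩ, heΓ, hek⟩ := exists_openPartialHomeomorph_contDiffOn_symm
    (F := (A →L[ℝ] ℝ) × F) hk0 hΩ hΓk hmΩ hΓ' hbij
  have hι : Continuous fun z : F => ((0 : A →L[ℝ] ℝ), z) := by fun_prop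
  have hΓe : ∀ x ∈ φ.source, e (φ x) = (f x, ψ (P.g x)) := fun x hx => by
    rw [heΓ, hΓ]
    simp only [φ.left_inv hx]
  refine ⟨φ.source ∩ φ ⁻¹' e.source,
    ψ.source ∩ ψ ⁻¹' ((fun z : F => ((0 : A →L[ℝ] ℝ), z)) ⁻¹' e.target),
    fun y => φ.symm (e.symm (0, ψ y)), ?_, ⟨mem_extChartAt_source m, hme⟩, ?_, ?_, ?_, ?_, ?_, ?_⟩
  · exact (continuousOn_extChartAt m).isOpen_inter_preimage (isOpen_extChartAt_source m)
      e.open_source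
  · exact (continuousOn_extChartAt _).isOpen_inter_preimage (isOpen_extChartAt_source _)
      (e.open_target.preimage hι)
  · refine ⟨mem_extChartAt_source _, ?_⟩
    have h1 := e.map_source hme
    rw [hΓe m (mem_extChartAt_source m), (hcrit_iff m hmU₀).1 h.1.1] at h1
    exact h1
  · intro y hy
    have h1 := e.map_target hy.2
    refine ⟨φ.map_target (heΩ h1).1, ?_⟩
    rw [mem_preimage, φ.right_inv (heΩ h1).1]
    exact h1
  · have hψk : ContMDiffOn J 𝓘(ℝ, F) (k : WithTop ℕ∞) ψ ψ.source := by
      rw [hψ, extChartAt_source]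
      exact contMDiffOn_extChartAt
    have hιk : ContDiff ℝ (k : WithTop ℕ∞) fun z : F => ((0 : A →L[ℝ] ℝ), z) :=
      contDiff_const.prodMk contDiff_id
    refine hφs.comp (hek.contMDiffOn.comp (hιk.contMDiff.comp_contMDiffOn
      (hψk.mono inter_subset_left)) fun y hy => hy.2) fun y hy => heΩ (e.map_target hy.2)
  · intro y hy
    have hx := heΩ (e.map_target hy.2)
    have h1 : Γ (e.symm (0, ψ y)) = (0, ψ y) := by
      rw [← heΓ]; exact e.right_inv hy.2
    exact ⟨(hcrit_iff _ hx.2.1).2 (congrArg Prod.fst h1),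
      ψ.injOn hx.2.2 hy.1 (congrArg Prod.snd h1)⟩
  · rintro y hy x ⟨hxs, hxe⟩ ⟨hxα, rfl⟩
    have hx₀ : x ∈ U₀ := by
      have := (heΩ hxe).2.1
      rwa [φ.left_inv hxs] at this
    have h1 := hΓe x hxs
    rw [(hcrit_iff x hx₀).1 hxα] at h1
    change x = φ.symm (e.symm (0, ψ (P.g x)))
    rw [← h1, e.left_inv hxe, φ.left_inv hxs]

end SkewCriticalProblem

end SkewCritical

theorem mainTheorem2 {E F : Type*}
    [NormedAddCommGroup E] [NormedSpace ℝ E] [CompleteSpace E]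
    [NormedAddCommGroup F] [NormedSpace ℝ F] [CompleteSpace F]
    {H G : Type*} [TopologicalSpace H] [TopologicalSpace G]
    (I : ModelWithCorners ℝ E H) [I.Boundaryless] (J : ModelWithCorners ℝ F G) [J.Boundaryless]
    {M N : Type*} [TopologicalSpace M] [ChartedSpace H M]
    [TopologicalSpace N] [ChartedSpace G N]
    (k : ℕ∞) (hk : 1 ≤ k)
    [IsManifold I 1 M] [IsManifold I ((k : WithTop ℕ∞) + 1) M] [IsManifold J (k : WithTop ℕ∞) N]
    [T2Space N] [ParacompactSpace N]
    (P : SkewCritical.SkewCriticalProblem I J M N k)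
    (M₀ : Set M) (hM₀ : IsClosed M₀) (hM₀' : SkewCritical.IsSubmanifold I k M₀)
    (N₀ : Set N) (hN₀ : IsClosed N₀) (hN₀' : SkewCritical.IsSubmanifold J k N₀)
    (γ₀ : N → M) (hγ₀ : SkewCritical.IsDiffeoOn J I k γ₀ N₀ M₀)
    (hnondeg : ∀ n ∈ N₀, P.IsNondegenerateAt (γ₀ n) n) :
    ∃ (U : Set M) (V : Set N) (γ : N → M),
      IsOpen U ∧ M₀ ⊆ U ∧ IsOpen V ∧ N₀ ⊆ V ∧
      MapsTo γ V U ∧ ContMDiffOn J I (k : WithTop ℕ∞) γ V ∧ EqOn γ γ₀ N₀ ∧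
      (∀ n ∈ V, P.IsCriticalAt (γ n) n) ∧
      (∀ n ∈ V, ∀ m ∈ U, P.IsCriticalAt m n → m = γ n) := by
  have : IsManifold I (k : WithTop ℕ∞) M :=
    IsManifold.of_le (n := (k : WithTop ℕ∞) + 1) le_self_add
  obtain ⟨U, V, γ, hU, hM₀U, hV, hN₀V, hγVU, hγk, hγγ₀, hγC, huniq⟩ :=
    SkewCritical.exists_open_glued_section (I := I) (J := J) (k := (k : WithTop ℕ∞))
      (C := {m | ∀ v ∈ P.D m, P.α m v = 0}) P.contMDiff_g.continuous hN₀
      hγ₀.contMDiffOn.continuousOn (fun n hn => (hnondeg n hn).1) (fun n hn => by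
        obtain ⟨U, V, s, hU, hnU, hV, hnV, hsVU, hsk, hsC, huniq⟩ :=
          P.exists_local_section hk (hnondeg n hn)
        exact ⟨U, V, s, hU, hnU, hV, hnV, hsVU, hsk, hsC,
          fun y hy m hm hmC hmy => huniq y hy m hm ⟨hmC, hmy⟩⟩)
  rw [hγ₀.bijOn.image_eq] at hM₀U
  exact ⟨U, V, γ, hU, hM₀U, hV, hN₀V, hγVU, hγk, hγγ₀, hγC,
    fun n hn m hm hmn => huniq n hn m hm hmn.1 hmn.2⟩
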